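/- For $m\ge 0$ and a permutation $\pi=\pi(1)\cdots\pi(m)\in\mathfrak S_m$ let $\mathrm{as}(\pi)$ be the length of the longest alternating subsequence $\pi(i_1)>\pi(i_2)<\pi(i_3)>\cdots\pi(i_k)$, $1\le i_1<\cdots<i_k\le m$, of $\pi$, and let $S_m(x)=\sum_{\pi\in\mathfrak S_m}x^{\mathrm{as}(\pi)}$ be the up-down run polynomial (so $S_0(x)=1$). For $m\ge 1$ let $\mathcal B_m$ be the hyperoctahedral group, that is, the permutations $\pi$ of $\{\pm1,\dots,\pm m\}$ with $\pi(-i)=-\pi(i)$, and identify $\pi\in\mathcal B_m$ with the word $\pi(0)\pi(1)\cdots\pi(m)$, where $\pi(0)=0$. An alternating run of $\pi$ is a maximal consecutive subword of this word that is increasing or decreasing in the usual order of the integers. Let $T(m,k)$ be the number of $\pi\in\mathcal B_m$ with $\pi(1)>0$ (up signed permutations) that have exactly $k$ alternating runs, and let $T_m(x)=\sum_{k=1}^m T(m,k)x^k$ be the type $B$ alternating run polynomial over up signed permutations. For $m\ge 1$ let $$t_m(x)=\begin{cases}(1+x)(1-x^2)^{k-1}, & m=2k-1,\\ -(1-x^2)^k,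 & m=2k.\end{cases}$$ Theorem. For every $n\ge 1$, $T_{n+1}(x)=\det\,(h_{i,j})_{0\le i,j\le n}$, where $(h_{i,j})$ is the lower Hessenberg matrix of order $n+1$ with entries $$h_{i,0}=2^i x\,S_i(x)\quad(0\le i\le n),\qquad h_{i,j}=\binom{i}{j-1}\,t_{i-j+1}(x)\quad(1\le j\le i\le n),$$ $$h_{i,i+1}=-\binom{i}{i}=-1\quad(0\le i\le n-1),\qquad h_{i,j}=0\quad(j>i+1),$$ that is, $$T_{n+1}(x)=\begin{vmatrix} x&-1&0&\cdots&0&0\\ 2xS_1(x)&1+x&-\binom11&\cdots&0&0\\ 2^2xS_2(x)&-(1-x^2)&\binom21(1+x)&\cdots&0&0\\ \vdots&\vdots&\vdots&\ddots&\vdots&\vdots\\ 2^{n-1}xS_{n-1}(x)&t_{n-1}(x)&\binom{n-1}{1}t_{n-2}(x)&\cdots&\binom{n-1}{n-2}(1+x)&-\binom{n-1}{n-1}\\ 2^{n}xS_n(x)&t_n(x)&\binom n1t_{n-1}(x)&\cdots&-\binom n{n-2}(1-x^2)&\binom n{n-1}(1+x) \end{vmatrix}.$$ -/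

import Mathlib

open Polynomial

namespace AltRun

/-- A sequence of positions `f 0 < f 1 < ⋯ < f (k-1)` picks out an alternating subsequence
`w (f 0) > w (f 1) < w (f 2) > ⋯` (starting with a descent) of the word `w`. -/
def IsAlternatingSubseq {n k : ℕ} (w : Fin n → ℤ) (f : Fin k → Fin n) : Prop :=
  StrictMono f ∧
    ∀ i j : Fin k, (j : ℕ) = (i : ℕ) + 1 →
      if Even (i : ℕ) then w (f j) < w (f i) else w (f i) < w (f j)

/-- The one-line word `π(1) ⋯ π(n)` of a permutation of `[n]`; `Fin n` stands for
`[n] = {1, …, n}` through `i ↦ i + 1`. -/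
def permWord {n : ℕ} (π : Equiv.Perm (Fin n)) : Fin n → ℤ := fun i => ((π i : ℕ) : ℤ) + 1

/-- The length of the longest alternating subsequence of a permutation.
(The set of lengths contains `0` and is bounded by `n`.) -/
noncomputable def altSubseqLength {n : ℕ} (π : Equiv.Perm (Fin n)) : ℕ :=
  sSup {k : ℕ | ∃ f : Fin k → Fin n, IsAlternatingSubseq (permWord π) f}

/-- The up-down run polynomial `S_n(x) = ∑_{π ∈ 𝔖_n} x ^ as(π)`. -/
noncomputable def upDownRunPoly (n : ℕ) : ℤ[X] :=
  ∑ π : Equiv.Perm (Fin n), X ^ altSubseqLength π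

/-- The set `±[n] = {±1, …, ±n}`. -/
noncomputable def pmRange (n : ℕ) : Finset ℤ := (Finset.Icc (-(n : ℤ)) n).erase 0

/-- The hyperoctahedral group `B_n`: permutations `π` of `±[n]` with `π(-i) = -π(i)`. -/
abbrev SignedPerm (n : ℕ) : Type :=
  {π : Equiv.Perm (pmRange n) // ∀ i j : pmRange n, (j : ℤ) = -(i : ℤ) → (π j : ℤ) = -(π i : ℤ)}

theorem succ_mem_pmRange {n : ℕ} (i : Fin n) : ((i : ℕ) : ℤ) + 1 ∈ pmRange n := by
  have := i.isLt
  simp only [pmRange, Finset.mem_erase, Finset.mem_Icc]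
  omega

/-- The word `π(0) π(1) ⋯ π(n)` of a signed permutation, where `π(0) = 0`. -/
noncomputable def signedWord {n : ℕ} (π : SignedPerm n) : Fin (n + 1) → ℤ :=
  Fin.cons 0 (fun i : Fin n => (π.1 ⟨((i : ℕ) : ℤ) + 1, succ_mem_pmRange i⟩ : ℤ))

/-- The segment `w i, …, w j` of the word `w` has at least two letters and is increasing or
decreasing. -/
def IsMonotoneSegment {m : ℕ} (w : Fin m → ℤ) (i j : Fin m) : Prop :=
  i < j ∧ (StrictMonoOn w (Set.Icc i j) ∨ StrictAntiOn w (Set.Icc i j))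

/-- The segment of `w` from position `i` to position `j` is an alternating run: it is a maximal
monotone segment. -/
def IsRun {m : ℕ} (w : Fin m → ℤ) (i j : Fin m) : Prop :=
  IsMonotoneSegment w i j ∧
    ∀ i' j' : Fin m, i' ≤ i → j ≤ j' → IsMonotoneSegment w i' j' → i' = i ∧ j' = j

/-- The number of alternating runs of a word. -/
noncomputable def runCount {m : ℕ} (w : Fin m → ℤ) : ℕ :=
  Nat.card {p : Fin m × Fin m // IsRun w p.1 p.2}

/-- `π` is an up signed permutation: `π(1) > 0`. -/
def IsUp {n : ℕ} (π : SignedPerm n) : Prop :=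
  ∀ i : Fin (n + 1), (i : ℕ) = 1 → 0 < signedWord π i

/-- `T(n,k)`: the number of up signed permutations in `B_n` with `k` alternating runs. -/
noncomputable def upSignedCount (n k : ℕ) : ℕ :=
  Nat.card {π : SignedPerm n // IsUp π ∧ runCount (signedWord π) = k}

/-- The type `B` alternating run polynomial over up signed permutations,
`T_n(x) = ∑_{k=1}^n T(n,k) x^k`. -/
noncomputable def typeBRunPoly (n : ℕ) : ℤ[X] :=
  ∑ k ∈ Finset.Icc 1 n, (upSignedCount n k : ℤ[X]) * X ^ k

/-- `t_n(x) = (1+x)(1-x²)^(k-1)` if `n = 2k-1`, and `t_n(x) = -(1-x²)^k` if `n = 2k`. -/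
noncomputable def tPoly (n : ℕ) : ℤ[X] :=
  if Odd n then (1 + X) * (1 - X ^ 2) ^ ((n + 1) / 2 - 1) else -(1 - X ^ 2) ^ (n / 2)

end AltRun

namespace AltRun

/-! The determinant encodes the recurrence T_{n+1} = 2^n x S_n + ∑_{k<n} C(n,k) t_{n-k} T_{k+1}
(`typeBRunPoly_succ_eq`, `det_hessenberg`). With u_0 = 1 and u_m = -t_m it becomes the binomial
convolution ∑ C(n,k) T_{k+1} u_{n-k} = 2^n x S_n.

The families T_{n+1}, u_n and 2^n x S_n each satisfy F_{n+1} = (c_F + nq) F_n + r F_n' with common q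
= 2x² and r = 2x(1-x²). The Leibniz and Pascal rules show that such recurrences survive binomial
convolution, with the constants c_F adding up (`sum_choose_mul_mul_eq`).

The recurrences for S and T come from inserting a letter of largest absolute value
(`upDownRunPoly_succ`, `signedRunPoly_succ_succ`). Both statistics are counts of direction changes
in the word prefixed by 0. If there are k changes, k insertions of a new maximum keep the count, one
adds 1 and the others add 2 (`insertSum_eq`). In the signed case a correction arises when the word
starts below 0; negation pairs it with the opposite sign of the inserted letter. -/

/-! ### Hessenberg determinants -/

/-- The determinant of a lower Hessenberg matrix with superdiagonal `-1` satisfies the recurrence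
obtained by expanding along the last row. -/
theorem det_hessenberg {R : Type*} [CommRing R] (n : ℕ) (h : ℕ → ℕ → R) (D : ℕ → R)
    (h0 : D 0 = 1) (hsup : ∀ i, h i (i + 1) = -1) (hzero : ∀ i j, i + 1 < j → h i j = 0)
    (hD : ∀ i ≤ n, D (i + 1) = ∑ j ∈ Finset.range (i + 1), h i j * D j) :
    (Matrix.of fun i j : Fin (n + 1) => h i j).det = D (n + 1) := by
  set A : Matrix (Fin (n + 1)) (Fin (n + 1)) R := Matrix.of fun i j => h i j with hA
  have hcol : (fun i : Fin (n + 1) => ∑ j : Fin (n + 1), D j • A i j) =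
      fun i => if i = Fin.last n then D (n + 1) else 0 := by
    funext i
    have hsum : ∑ j : Fin (n + 1), D j • A i j = ∑ j ∈ Finset.range (n + 1), h i j * D j := by
      rw [Finset.sum_range]
      exact Finset.sum_congr rfl fun j _ => by simp [hA, mul_comm]
    rw [hsum]
    by_cases hi : i = Fin.last n
    · subst hi
      simp [hD n le_rfl]
    · have hlt : (i : ℕ) + 2 ≤ n + 1 := by
        have := i.isLt
        have : (i : ℕ) ≠ n := fun h' => hi (Fin.ext h')
        omega
      rw [if_neg hi, ← Finset.sum_range_add_sum_Ico _ hlt, Finset.sum_eq_zero (s := Finset.Ico _ _),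
        Finset.sum_range_succ, ← hD i (by omega), hsup]
      · ring
      · intro j hj
        rw [hzero _ _ (by have := (Finset.mem_Ico.1 hj).1; omega), zero_mul]
  -- Column 0 enters the combination with weight `D 0 = 1`, so the determinant is unchanged; the new
  -- column has a single nonzero entry, at the bottom, and its minor is triangular with diagonal -1.
  have h1 := Matrix.det_updateCol_sum A 0 (fun j => D j)
  rw [hcol] at h1
  simp only [Fin.val_zero, h0, one_smul] at h1
  rw [← h1, Matrix.det_succ_column_zero, Finset.sum_eq_single (Fin.last n)]
  · have htri : ((A.updateCol 0 fun i => if i = Fin.last n then D (n + 1) else 0).submatrix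
        (Fin.last n).succAbove Fin.succ).det = (-1) ^ n := by
      rw [Matrix.det_of_isLowerTriangular]
      · simp [hA, Fin.succ_ne_zero, hsup]
      · intro i j hij
        have hij' : (i : ℕ) < j := hij
        simp only [Matrix.submatrix_apply, Matrix.updateCol_apply, Fin.succ_ne_zero, if_false, hA,
          Matrix.of_apply, Fin.succAbove_last, Fin.val_castSucc, Fin.val_succ]
        exact hzero _ _ (by omega)
    rw [htri]
    simp only [Fin.val_last, Matrix.updateCol_self, if_true]
    rw [mul_right_comm, ← mul_pow]
    simp
  · intro i _ hi
    simp [hi]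
  · simp

/-! ### Differential recurrences and binomial convolution -/

/-- `uPoly 0 = 1` and `uPoly m = -t_m` for `m ≥ 1`. -/
noncomputable def uPoly (m : ℕ) : ℤ[X] :=
  if Even m then (1 - X ^ 2) ^ (m / 2) else -((1 + X) * (1 - X ^ 2) ^ (m / 2))

theorem tPoly_succ (m : ℕ) : tPoly (m + 1) = -uPoly (m + 1) := by
  unfold tPoly uPoly
  rcases Nat.even_or_odd (m + 1) with h | h
  · rw [if_neg (Nat.not_odd_iff_even.2 h), if_pos h]
  · rw [if_pos h, if_neg (Nat.not_even_iff_odd.2 h), neg_neg]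
    obtain ⟨k, hk⟩ := h
    rw [hk, show (2 * k + 1 + 1) / 2 - 1 = k by omega, show (2 * k + 1) / 2 = k by omega]

/-- Both parities reduce to (1-x²) d/dx (1-x²)^k = -2kx(1-x²)^k. The shape is chosen to share q and
r with the recurrences for T and S. -/
theorem uPoly_succ (m : ℕ) :
    uPoly (m + 1) = (-X - 1 + 2 * (m : ℤ[X]) * X ^ 2) * uPoly m +
      2 * X * (1 - X ^ 2) * derivative (uPoly m) := by
  have hder (k : ℕ) : (1 - X ^ 2 : ℤ[X]) * derivative ((1 - X ^ 2 : ℤ[X]) ^ k) =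
      -(2 * (k : ℤ[X]) * X * (1 - X ^ 2) ^ k) := by
    cases k with
    | zero => simp
    | succ k =>
      rw [derivative_pow]
      simp only [derivative_sub, derivative_one, derivative_X_pow, map_natCast, Nat.add_sub_cancel]
      push_cast
      ring
  rcases Nat.even_or_odd' m with ⟨k, rfl | rfl⟩
  · have e1 : uPoly (2 * k) = (1 - X ^ 2) ^ k := by simp [uPoly]
    have e2 : uPoly (2 * k + 1) = -((1 + X) * (1 - X ^ 2) ^ k) := by
      rw [uPoly, if_neg (by simp), show (2 * k + 1) / 2 = k by omega]
    rw [e1, e2]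
    push_cast
    linear_combination (-2 * X) * hder k
  · have e1 : uPoly (2 * k + 1 + 1) = (1 - X ^ 2) ^ (k + 1) := by
      rw [uPoly, if_pos (by simp [parity_simps]), show (2 * k + 1 + 1) / 2 = k + 1 by omega]
    have e2 : uPoly (2 * k + 1) = -((1 + X) * (1 - X ^ 2) ^ k) := by
      rw [uPoly, if_neg (by simp), show (2 * k + 1) / 2 = k by omega]
    rw [e1, e2, derivative_neg, derivative_mul]
    simp only [derivative_add, derivative_one, derivative_X]
    push_cast
    linear_combination (2 * X * (1 + X)) * hder k

/-- Two families of polynomials satisfying compatible differential recurrences have a binomial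
convolution satisfying a differential recurrence. -/
theorem sum_choose_mul_mul_eq {A B C : ℕ → ℤ[X]} {a b c q r : ℤ[X]} (hc : c = a + b)
    (hA : ∀ n, A (n + 1) = (a + n * q) * A n + r * derivative (A n))
    (hB : ∀ n, B (n + 1) = (b + n * q) * B n + r * derivative (B n))
    (hC : ∀ n, C (n + 1) = (c + n * q) * C n + r * derivative (C n))
    (h0 : C 0 = A 0 * B 0) (n : ℕ) :
    ∑ p ∈ Finset.HasAntidiagonal.antidiagonal n, (n.choose p.1 : ℤ[X]) * (A p.1 * B p.2) = C n := by
  induction n with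
  | zero => simp [h0]
  | succ n ih =>
    rw [Finset.sum_antidiagonal_choose_succ_mul (fun i j => A i * B j), hC, ← ih,
      derivative_sum, Finset.mul_sum, Finset.mul_sum, ← Finset.sum_add_distrib,
      ← Finset.sum_add_distrib]
    refine Finset.sum_congr rfl fun p hp => ?_
    rw [Finset.HasAntidiagonal.mem_antidiagonal] at hp
    -- By symmetry both Pascal terms carry the same coefficient; with n = p.1 + p.2 the term nq
    -- splits between the two factors, and the derivatives combine by Leibniz.
    rw [Nat.choose_symm_of_eq_add hp.symm, hA, hB, ← hp, hc]
    simp only [derivative_mul, derivative_natCast]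
    push_cast
    ring

/-! ### Direction changes and insertion of a maximum -/

/-- The number of changes of direction in the word `a :: l`, where `d` is the direction in which
the letter `a` was reached (`true` for up). -/
def turns : Bool → ℤ → List ℤ → ℕ
  | _, _, [] => 0
  | d, a, b :: l => (if d = decide (a < b) then 0 else 1) + turns (decide (a < b)) b l

/-- The sum of `X ^ turns` over all insertions of the letter `M` into the word `l`. -/
noncomputable def insertSum (M : ℤ) (d : Bool) (a : ℤ) (l : List ℤ) : ℤ[X] :=
  ∑ p ∈ Finset.range (l.length + 1), X ^ turns d a (l.insertIdx p M)

theorem insertSum_cons (M : ℤ) (d : Bool) (a b : ℤ) (l : List ℤ) :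
    insertSum M d a (b :: l) = X ^ turns d a (M :: b :: l) +
      X ^ (if d = decide (a < b) then 0 else 1) * insertSum M (decide (a < b)) b l := by
  simp only [insertSum, List.length_cons]
  rw [Finset.sum_range_succ', add_comm, Finset.mul_sum]
  simp [turns, pow_add]

theorem insertSum_nil {M a : ℤ} (h : a < M) (d : Bool) :
    insertSum M d a [] = if d then 1 else X := by
  cases d <;> simp [insertSum, turns, h]

/-- `k x ^ k + x ^ (k + 1) + (n - k) x ^ (k + 2)`. -/
noncomputable def insertPoly (k n : ℕ) : ℤ[X] :=
  (k : ℤ[X]) * X ^ k + X ^ (k + 1) + ((n : ℤ[X]) - (k : ℤ[X])) * X ^ (k + 2)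

/-- An insertion of `M` next to a peak merely moves the peak, as does appending `M` after a final
ascent; one further position adds one turn, and any other creates a new peak and valley. The second
half is needed for the induction: after an ascent into `a`, the effect of inserting just before `a`
depends on the step that follows, so that gap is counted along. -/
theorem insertSum_eq {M : ℤ} (l : List ℤ) (a : ℤ) (ha : a < M) (hl : ∀ b ∈ l, b < M) :
    insertSum M false a l = insertPoly (turns false a l) l.length ∧
    ∀ z, z < a → insertSum M true z (a :: l) = ((turns true z (a :: l) : ℤ[X]) + 1) * X ^ turns true z (a :: l)
      + X ^ (turns true z (a :: l) + 1) +
      ((l.length : ℤ[X]) - (turns true z (a :: l) : ℤ[X])) * X ^ (turns true z (a :: l) + 2) := by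
  induction l generalizing a with
  | nil =>
    refine ⟨by simp [insertSum_nil ha, insertPoly, turns], fun z hz => ?_⟩
    rw [insertSum_cons, decide_eq_true hz, insertSum_nil ha]
    simp [turns, hz, hz.trans ha, not_lt.2 ha.le]
    ring
  | cons b l ih =>
    have hb : b < M := hl b (by simp)
    obtain ⟨ih1, ih2⟩ := ih b hb fun c hc => hl c (by simp [hc])
    have hMb : ¬ M < b := not_lt.2 hb.le
    have hMa : ¬ M < a := not_lt.2 ha.le
    constructor
    · by_cases hab : a < b
      · have h3 := ih2 a hab
        -- Every insertion leaves `a` by an ascent, so arriving downwards costs exactly one more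
        -- turn.
        have e : insertSum M false a (b :: l) = X * insertSum M true a (b :: l) := by
          rw [insertSum_cons, insertSum_cons]
          simp [turns, hab, ha]
          ring
        have e2 : turns false a (b :: l) = turns true a (b :: l) + 1 := by
          simp [turns, hab, add_comm]
        rw [e, h3, e2, insertPoly, List.length_cons]
        push_cast
        ring
      · rw [insertSum_cons, decide_eq_false hab, ih1]
        simp [turns, hab, ha, hMb, insertPoly]
        ring
    · intro z hz
      rw [insertSum_cons, decide_eq_true hz]
      have hzM : z < M := hz.trans ha
      by_cases hab : a < b
      · rw [ih2 a hab]
        simp [turns, hab, hz, hzM, hMa]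
        ring
      · rw [insertSum_cons, decide_eq_false hab, ih1]
        simp [turns, hab, hz, hzM, hMa, insertPoly, ha, hMb]
        ring

/-! ### Run counts of lists -/

/-- The number of alternating runs of the word `a :: l`. -/
def runs (a : ℤ) (l : List ℤ) : ℕ :=
  match l with
  | [] => 0
  | b :: l => turns (!decide (a < b)) a (b :: l)

theorem runs_le (a : ℤ) (l : List ℤ) : runs a l ≤ l.length := by
  have h (l : List ℤ) : ∀ d a, turns d a l ≤ l.length := by
    induction l with
    | nil => simp [turns]
    | cons b l ih =>
      intro d a
      simp only [turns, List.length_cons]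
      have := ih (decide (a < b)) b
      split_ifs <;> omega
  cases l with
  | nil => simp [runs]
  | cons b l => exact h _ _ _

theorem runs_pos (a : ℤ) {l : List ℤ} (hl : l ≠ []) : 1 ≤ runs a l := by
  cases l with
  | nil => exact absurd rfl hl
  | cons b l => simp [runs, turns]

/-- Negation reverses every step; distinct letters exclude ties, which would count as descents on
both sides. -/
theorem runs_neg (a : ℤ) (l : List ℤ) (h : (a :: l).Nodup) :
    runs (-a) (l.map Neg.neg) = runs a l := by
  have h2 (l : List ℤ) : ∀ d a, (a :: l).Nodup →
      turns d (-a) (l.map Neg.neg) = turns (!d) a l := by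
    induction l with
    | nil => simp [turns]
    | cons b l ih =>
      intro d a h
      have hab : a ≠ b := fun h' => by simp [h'] at h
      have hd : decide (-a < -b) = !decide (a < b) := by
        by_cases h' : a < b
        · simp [h', h'.le]
        · simp [h', lt_of_le_of_ne (not_lt.1 h') hab.symm]
      simp only [List.map_cons, turns, hd, ih _ b h.of_cons, Bool.not_not]
      cases d <;> simp
  cases l with
  | nil => simp [runs]
  | cons b l =>
    have hab : a ≠ b := fun h' => by simp [h'] at h
    have hd : decide (-a < -b) = !decide (a < b) := by
      by_cases h' : a < b
      · simp [h', h'.le]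
      · simp [h', lt_of_le_of_ne (not_lt.1 h') hab.symm]
    have := h2 (b :: l) (decide (a < b)) a h
    simp only [List.map_cons] at this
    simp only [runs, List.map_cons, hd, Bool.not_not, this]

/-- If the first step is up, runs are turns after a downward arrival. If it is down, only the
insertion in front of `b` behaves differently: it adds one run, and the insertions after `b` have
one neutral position fewer. -/
theorem sum_runs_insertIdx {M : ℤ} {a b : ℤ} {l : List ℤ} (ha : a < M)
    (hl : ∀ c ∈ b :: l, c < M) :
    ∑ p ∈ Finset.range ((b :: l).length + 1), X ^ runs a ((b :: l).insertIdx p M) =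
      insertPoly (runs a (b :: l)) (b :: l).length +
        if a < b then (0 : ℤ[X]) else X ^ (runs a (b :: l) + 1) - X ^ runs a (b :: l) := by
  have hb : b < M := hl b (by simp)
  have h1 : ∀ c ∈ l, c < M := fun c hc => hl c (by simp [hc])
  have hMb : ¬ M < b := not_lt.2 hb.le
  by_cases hab : a < b
  · rw [if_pos hab, add_zero]
    have := (insertSum_eq (b :: l) a ha hl).1
    simp only [insertSum] at this
    have e : runs a (b :: l) = turns false a (b :: l) := by simp [runs, hab]
    rw [e, ← this]
    refine Finset.sum_congr rfl fun p _ => ?_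
    cases p <;> simp [runs, hab, ha]
  · rw [if_neg hab, Finset.sum_range_succ']
    have h2 := (insertSum_eq l b hb h1).1
    simp only [List.insertIdx_succ_cons, List.insertIdx_zero, runs, turns, hab, ha, hMb,
      List.length_cons, pow_add]
    simp only [decide_true, decide_false, Bool.not_true, Bool.not_false, reduceIte,
      Bool.false_eq_true, Bool.true_eq_false, pow_one, ← Finset.mul_sum]
    rw [insertSum] at h2
    rw [h2, insertPoly, insertPoly]
    push_cast
    ring

/-! ### Longest alternating subsequences as turn counts -/

/-- The word is alternating, its first step going up if `d` is `true` and down otherwise. -/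
def Alternates : Bool → List ℤ → Prop
  | _, [] => True
  | _, [_] => True
  | d, a :: b :: l => (if d then a < b else b < a) ∧ Alternates (!d) (b :: l)

theorem Alternates.tail {d : Bool} {L : List ℤ} (h : Alternates d L) : Alternates (!d) L.tail := by
  match L, h with
  | [], _ => trivial
  | [_], _ => trivial
  | _ :: _ :: _, h => exact h.2

theorem alternates_iff (d : Bool) (L : List ℤ) :
    Alternates d L ↔ ∀ i (h : i + 1 < L.length),
      if (Even i ↔ d = true) then L[i] < L[i + 1] else L[i + 1] < L[i] := by
  match L with
  | [] => simp [Alternates]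
  | [_] => simp [Alternates]
  | a :: b :: l =>
    rw [Alternates, alternates_iff (!d) (b :: l)]
    constructor
    · rintro ⟨h1, h2⟩ i hi
      cases i with
      | zero => simpa using h1
      | succ i =>
        have := h2 i (by simpa using hi)
        simp only [List.getElem_cons_succ]
        cases d <;> simpa [Nat.even_add_one] using this
    · intro h
      refine ⟨by simpa using h 0 (by simp), fun i hi => ?_⟩
      have := h (i + 1) (by simpa using hi)
      simp only [List.getElem_cons_succ] at this
      cases d <;> simpa [Nat.even_add_one] using this

/-- If the step from `a` to `b` continues direction `d`, a chosen initial `a` may be replaced by the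
more extreme `b`. Otherwise dropping the first chosen letter is paid for by the turn at `a`. -/
theorem Alternates.length_le {d : Bool} {a : ℤ} {l L : List ℤ} (hL : L.Sublist (a :: l))
    (h : Alternates (!d) L) : L.length ≤ turns d a l + 1 := by
  induction l generalizing d a L with
  | nil => simpa [turns] using hL.length_le
  | cons b l ih =>
    by_cases hd : d = decide (a < b)
    · rw [turns, if_pos hd, ← hd, zero_add]
      cases hL with
      | cons _ hL => exact ih hL h
      | cons_cons _ hL =>
        rename_i L
        match L, hL, h with
        | [], _, _ => simp
        | c :: L, hL, h =>
          have hs := h.1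
          cases hL with
          | cons_cons _ hL =>
            cases d <;> simp_all <;> omega
          | cons _ hL =>
            have := ih (d := d) (hL.cons_cons b) ⟨by cases d <;> simp_all <;> omega, h.2⟩
            simpa using this
    · have hd' : decide (a < b) = !d := by
        cases d <;> simp_all
      rw [turns, if_neg hd, hd']
      have ht : L.tail.Sublist (b :: l) := by
        cases hL with
        | cons _ hL => exact (List.tail_sublist _).trans hL
        | cons_cons _ hL => exact hL
      have := ih ht h.tail
      rw [List.length_tail] at this
      omega

theorem exists_alternates (d : Bool) {a : ℤ} {l : List ℤ} (hn : (a :: l).Nodup) :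
    ∃ L : List ℤ, L.Sublist (a :: l) ∧ Alternates (!d) L ∧ L.length = turns d a l + 1 := by
  induction l generalizing d a with
  | nil => exact ⟨[a], by simp, trivial, by simp [turns]⟩
  | cons b l ih =>
    have hab : a ≠ b := fun h' => by simp [h'] at hn
    obtain ⟨L, hL, hA, hlen⟩ := ih (decide (a < b)) hn.of_cons
    by_cases hd : d = decide (a < b)
    · exact ⟨L, hL.cons a, by rwa [hd], by rw [hlen, turns, if_pos hd, ← hd, zero_add]⟩
    · have hd' : decide (a < b) = !d := by
        cases d <;> simp_all
      rw [turns, if_neg hd]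
      rw [hd'] at hA hlen ⊢
      have hstep : if !d then a < b else b < a := by
        cases d <;> simp_all <;> omega
      match L, hL, hA, hlen with
      | [], _, _, hlen => simp at hlen
      | c :: L, hL, hA, hlen =>
        cases hL with
        | cons_cons _ hL =>
          exact ⟨a :: b :: L, (hL.cons_cons _).cons_cons _, ⟨hstep, hA⟩, by
            simp only [List.length_cons] at hlen ⊢; omega⟩
        | cons _ hL =>
          match L, hL, hA, hlen with
          | [], _, _, hlen =>
            exact ⟨[a, b], by simp, ⟨hstep, trivial⟩, by simp at hlen ⊢; omega⟩
          | e :: L, hL, hA, hlen =>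
            have hs := hA.1
            -- Exchange: if `b` is at least as extreme as `c` it replaces `c` before `e`; otherwise
            -- `c` lies even further from `a` than `b`, so `a` can precede `c` directly.
            by_cases hc : if !d then c ≤ b else b ≤ c
            · refine ⟨a :: b :: e :: L, (((List.sublist_cons_self _ _).trans hL).cons_cons
                _).cons_cons _, ⟨hstep, ?_, hA.2⟩, ?_⟩
              · cases d <;> simp_all <;> omega
              · simp only [List.length_cons] at hlen ⊢; omega
            · refine ⟨a :: c :: e :: L, (hL.cons _).cons_cons _, ⟨?_, hA⟩, ?_⟩
              · cases d <;> simp_all <;> omega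
              · simp only [List.length_cons] at hlen ⊢; omega

theorem exists_isAlternatingSubseq_iff {n : ℕ} (w : Fin n → ℤ) (k : ℕ) :
    (∃ f : Fin k → Fin n, IsAlternatingSubseq w f) ↔
      ∃ L : List ℤ, L.Sublist (List.ofFn w) ∧ Alternates false L ∧ L.length = k := by
  constructor
  · rintro ⟨f, hf, h⟩
    refine ⟨List.ofFn (w ∘ f), ?_, ?_, by simp⟩
    · rw [List.sublist_iff_exists_fin_orderEmbedding_get_eq]
      refine ⟨OrderEmbedding.ofStrictMono
        (fun i => Fin.cast (by simp) (f (Fin.cast (by simp) i))) ?_, ?_⟩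
      · intro i j hij
        exact hf (show Fin.cast _ i < Fin.cast _ j from hij)
      · intro i
        simp [Fin.cast]
    · rw [alternates_iff]
      intro i hi
      simp only [List.length_ofFn] at hi
      have := h ⟨i, by omega⟩ ⟨i + 1, hi⟩ rfl
      simp only [List.getElem_ofFn, Function.comp_apply]
      by_cases he : Even i <;> simpa [he] using this
  · rintro ⟨L, hL, hA, rfl⟩
    rw [List.sublist_iff_exists_fin_orderEmbedding_get_eq] at hL
    obtain ⟨f, hf⟩ := hL
    refine ⟨fun i => Fin.cast (by simp) (f i), fun i j hij => ?_, fun i j hij => ?_⟩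
    · exact f.strictMono hij
    · rw [alternates_iff] at hA
      have hw (i : Fin L.length) : w (Fin.cast (by simp) (f i)) = L[i] := by
        have := hf i
        simp only [List.get_eq_getElem, List.getElem_ofFn] at this
        exact this.symm
      have := hA i (by omega)
      obtain ⟨j, hj⟩ := j
      dsimp only at hij
      subst hij
      dsimp only
      rw [hw, hw]
      by_cases he : Even (i : ℕ) <;> simpa [he] using this

/-- Prefixing the smaller letter 0 turns a subsequence starting with a descent into one starting
with an ascent and one letter longer, so the extra 1 in the turn bounds cancels. -/
theorem sSup_isAlternatingSubseq {n : ℕ} {w : Fin n → ℤ} (hw : ∀ i, 0 < w i)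
    (hinj : Function.Injective w) :
    sSup {k : ℕ | ∃ f : Fin k → Fin n, IsAlternatingSubseq w f} = turns false 0 (List.ofFn w) := by
  have hpos : ∀ c ∈ List.ofFn w, 0 < c := by
    intro c hc
    obtain ⟨i, rfl⟩ := (List.mem_ofFn' w c).1 hc
    exact hw i
  apply IsGreatest.csSup_eq
  constructor
  · have hn : ((0 : ℤ) :: List.ofFn w).Nodup :=
      List.nodup_cons.2 ⟨fun h => lt_irrefl _ (hpos 0 h), List.nodup_ofFn.2 hinj⟩
    obtain ⟨L, hL, hA, hlen⟩ := exists_alternates false hn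
    refine (exists_isAlternatingSubseq_iff w _).2 ⟨L.tail, ?_, hA.tail, by simp [hlen]⟩
    cases hL with
    | cons _ hL => exact (List.tail_sublist _).trans hL
    | cons_cons _ hL => exact hL
  · intro k hk
    obtain ⟨L, hL, hA, rfl⟩ := (exists_isAlternatingSubseq_iff w _).1 hk
    have h2 : Alternates (!false) (0 :: L) := by
      match L, hL, hA with
      | [], _, _ => trivial
      | c :: L, hL, hA => exact ⟨by simpa using hpos c (hL.subset (by simp)), hA⟩
    have := h2.length_le (hL.cons_cons 0)
    simpa using this

/-! ### Maximal monotone segments and direction changes -/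

theorem turns_eq_sum (d : Bool) (a : ℤ) (l : List ℤ) :
    turns d a l = ∑ i ∈ Finset.range l.length,
      if (if i = 0 then d else decide ((a :: l).getD (i - 1) 0 < (a :: l).getD i 0)) =
        decide ((a :: l).getD i 0 < (a :: l).getD (i + 1) 0) then 0 else 1 := by
  induction l generalizing d a with
  | nil => simp [turns]
  | cons b l ih =>
    rw [turns, List.length_cons, Finset.sum_range_succ', add_comm, ih]
    congr 1
    refine Finset.sum_congr rfl fun i _ => ?_
    cases i <;> simp

theorem runs_eq_card (a : ℤ) (l : List ℤ) :
    runs a l = ((Finset.range l.length).filter fun i => i = 0 ∨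
      decide ((a :: l).getD (i - 1) 0 < (a :: l).getD i 0) ≠
        decide ((a :: l).getD i 0 < (a :: l).getD (i + 1) 0)).card := by
  cases l with
  | nil => simp [runs]
  | cons b l =>
    rw [runs, turns_eq_sum, Finset.card_filter]
    refine Finset.sum_congr rfl fun i _ => ?_
    cases i with
    | zero => simp
    | succ i =>
      simp only [Nat.add_eq_zero_iff, one_ne_zero, and_false, if_false, false_or, ne_eq, ite_not]

theorem IsMonotoneSegment.lt_iff {m : ℕ} {v : Fin m → ℤ} {i j : Fin m}
    (h : IsMonotoneSegment v i j) {x y x' y' : Fin m} (hx : i ≤ x) (hxy : x < y) (hy : y ≤ j)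
    (hx' : i ≤ x') (hxy' : x' < y') (hy' : y' ≤ j) : v x < v y ↔ v x' < v y' := by
  have m1 : x ∈ Set.Icc i j := ⟨hx, hxy.le.trans hy⟩
  have m2 : y ∈ Set.Icc i j := ⟨hx.trans hxy.le, hy⟩
  have m3 : x' ∈ Set.Icc i j := ⟨hx', hxy'.le.trans hy'⟩
  have m4 : y' ∈ Set.Icc i j := ⟨hx'.trans hxy'.le, hy'⟩
  rcases h.2 with h | h
  · exact iff_of_true (h m1 m2 hxy) (h m3 m4 hxy')
  · exact iff_of_false (h m1 m2 hxy).not_gt (h m3 m4 hxy').not_gt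

/-- A segment preceded by a step in its own direction extends to the left, so no run starts there.
-/
theorem IsMonotoneSegment.cons_left {m : ℕ} {v : Fin m → ℤ} (hv : Function.Injective v)
    {z i i' j : Fin m} (h : IsMonotoneSegment v i j) (hz : (i : ℕ) = z + 1) (hi : (i' : ℕ) = i + 1)
    (hd : v z < v i ↔ v i < v i') : IsMonotoneSegment v z j := by
  have hij : i < j := h.1
  have hzi : z < i := Fin.lt_def.2 (by omega)
  have hii : i < i' := Fin.lt_def.2 (by omega)
  have hi'j : i' ≤ j := Fin.le_def.2 (by have := Fin.lt_def.1 hij; omega)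
  have mi : i ∈ Set.Icc i j := ⟨le_rfl, hij.le⟩
  have mi' : i' ∈ Set.Icc i j := ⟨hii.le, hi'j⟩
  have hmem : ∀ x ∈ Set.Icc z j, x = z ∨ x ∈ Set.Icc i j := by
    intro x hx
    rcases eq_or_lt_of_le hx.1 with h | h
    · exact Or.inl h.symm
    · exact Or.inr ⟨Fin.le_def.2 (by have := Fin.lt_def.1 h; omega), hx.2⟩
  refine ⟨hzi.trans hij, ?_⟩
  rcases h.2 with h | h
  · have hlt := hd.2 (h mi mi' hii)
    refine Or.inl fun x hx y hy hxy => ?_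
    rcases hmem x hx with rfl | hx'
    · rcases hmem y hy with rfl | hy'
      · exact absurd hxy (lt_irrefl _)
      · exact hlt.trans_le (h.monotoneOn mi hy' hy'.1)
    · rcases hmem y hy with rfl | hy'
      · exact absurd (hx'.1.trans_lt hxy) hzi.not_gt
      · exact h hx' hy' hxy
  · have hlt : v i < v z := lt_of_le_of_ne (not_lt.1 fun h' => (h mi mi' hii).not_gt (hd.1 h'))
      fun h' => hzi.ne' (hv h')
    refine Or.inr fun x hx y hy hxy => ?_
    rcases hmem x hx with rfl | hx'
    · rcases hmem y hy with rfl | hy'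
      · exact absurd hxy (lt_irrefl _)
      · exact (h.antitoneOn mi hy' hy'.1).trans_lt hlt
    · rcases hmem y hy with rfl | hy'
      · exact absurd (hx'.1.trans_lt hxy) hzi.not_gt
      · exact h hx' hy' hxy

theorem isMonotoneSegment_succ {m : ℕ} {v : Fin m → ℤ} (hv : Function.Injective v) {i j : Fin m}
    (hj : (j : ℕ) = i + 1) : IsMonotoneSegment v i j := by
  have hij : i < j := Fin.lt_def.2 (by omega)
  have hmem : ∀ x ∈ Set.Icc i j, x = i ∨ x = j := by
    intro x hx
    have h1 := Fin.le_def.1 hx.1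
    have h2 := Fin.le_def.1 hx.2
    simp only [Fin.ext_iff]
    omega
  refine ⟨hij, ?_⟩
  rcases lt_or_gt_of_ne (hv.ne hij.ne) with h | h
  · refine Or.inl fun x hx y hy hxy => ?_
    rcases hmem x hx with rfl | rfl <;> rcases hmem y hy with rfl | rfl
    all_goals first | exact h | exact absurd hxy (lt_irrefl _) | exact absurd hxy hij.not_gt
  · refine Or.inr fun x hx y hy hxy => ?_
    rcases hmem x hx with rfl | rfl <;> rcases hmem y hy with rfl | rfl
    all_goals first | exact h | exact absurd hxy (lt_irrefl _) | exact absurd hxy hij.not_gt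

/-- A run is determined by its left end, by maximality on the right. The left ends are position 0
and the positions where the direction changes; from each, the longest monotone segment is a run. -/
theorem runCount_eq_card {m : ℕ} {v : Fin (m + 1) → ℤ} (hv : Function.Injective v) :
    runCount v = Nat.card {i : Fin m // ∀ z : Fin m, (i : ℕ) = z + 1 →
      ¬ (v z.castSucc < v z.succ ↔ v i.castSucc < v i.succ)} := by
  refine Nat.card_congr (Equiv.ofBijective (fun p => ⟨⟨p.1.1, ?_⟩, ?_⟩) ⟨?_, ?_⟩)
  · have h1 := Fin.lt_def.1 p.2.1.1
    have := p.1.2.isLt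
    omega
  · intro z hz hd
    obtain ⟨⟨i, j⟩, hr, hmax⟩ := p
    dsimp only at hz hd hr hmax
    have hlt := Fin.lt_def.1 hr.1
    have hjlt := j.isLt
    have e1 : z.succ = i := Fin.ext (by simp [hz])
    rw [e1] at hd
    have := hr.cons_left hv (z := z.castSucc) (i' := ⟨i + 1, by omega⟩) (by simpa using hz) rfl hd
    have h2 := (hmax z.castSucc j (Fin.le_def.2 (by simp; omega)) le_rfl this).1
    have h3 := congrArg Fin.val h2
    simp only [Fin.val_castSucc] at h3
    omega
  · rintro ⟨⟨i, j⟩, hr, hmax⟩ ⟨⟨i', j'⟩, hr', hmax'⟩ h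
    simp only [Subtype.mk.injEq, Fin.mk.injEq] at h
    have h : i = i' := Fin.ext h
    subst h
    dsimp only at hr hmax hr' hmax'
    have : j = j' := by
      rcases le_total j j' with h | h
      · exact (hmax i j' le_rfl h hr').2.symm
      · exact (hmax' i j le_rfl h hr).2
    subst this
    rfl
  · rintro ⟨i, hi⟩
    classical
    obtain ⟨j, hj, hjmax⟩ := Finset.exists_max_image
      (Finset.univ.filter fun j => IsMonotoneSegment v i.castSucc j) id
      ⟨i.succ, by simpa using isMonotoneSegment_succ hv (by simp)⟩
    simp only [Finset.mem_filter, Finset.mem_univ, true_and, id] at hj hjmax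
    refine ⟨⟨(i.castSucc, j), hj, ?_⟩, by simp⟩
    intro i' j' hi' hj' hmon
    dsimp only at hi' hj' ⊢
    have hii : i' = i.castSucc := by
      by_contra hne
      have hlt := Fin.lt_def.1 (lt_of_le_of_ne hi' hne)
      have hij := Fin.lt_def.1 hj.1
      have hjj := Fin.le_def.1 hj'
      simp only [Fin.val_castSucc] at hlt hij
      have hilt := i.isLt
      refine hi ⟨i - 1, by omega⟩ (by simp; omega) (hmon.lt_iff ?_ ?_ ?_ ?_ ?_ ?_)
      all_goals simp only [Fin.le_def, Fin.lt_def, Fin.val_castSucc, Fin.val_succ]; omega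
    subst hii
    exact ⟨rfl, le_antisymm (hjmax j' hmon) hj'⟩

theorem runCount_cons {m : ℕ} {a : ℤ} {w : Fin m → ℤ}
    (hv : Function.Injective (Fin.cons a w : Fin (m + 1) → ℤ)) :
    runCount (Fin.cons a w : Fin (m + 1) → ℤ) = runs a (List.ofFn w) := by
  have hget (i : ℕ) (h : i < m + 1) :
      (a :: List.ofFn w).getD i 0 = (Fin.cons a w : Fin (m + 1) → ℤ) ⟨i, h⟩ := by
    have e : a :: List.ofFn w = List.ofFn (Fin.cons a w : Fin (m + 1) → ℤ) := by
      simp [List.ofFn_succ]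
    rw [e, List.getD_eq_getElem _ _ (by simpa using h), List.getElem_ofFn]
  rw [runCount_eq_card hv, runs_eq_card, ← Nat.card_eq_finsetCard]
  refine Nat.card_congr ⟨fun i => ⟨i.1, ?_⟩, fun i => ⟨⟨i.1, ?_⟩, ?_⟩, fun _ => rfl, fun _ => rfl⟩
  · obtain ⟨i, hi⟩ := i
    simp only [Finset.mem_filter, Finset.mem_range, List.length_ofFn]
    refine ⟨i.isLt, ?_⟩
    rcases Nat.eq_zero_or_pos (i : ℕ) with h | h
    · exact Or.inl h
    · refine Or.inr fun h' => hi ⟨i - 1, by omega⟩ (by simp; omega) ?_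
      rw [decide_eq_decide, hget _ (by omega), hget _ (by omega), hget _ (by omega)] at h'
      convert! h' using 3
      exact Fin.ext (by simp; omega)
  · have := (Finset.mem_filter.1 i.2).1
    simpa using this
  · obtain ⟨i, hi⟩ := i
    simp only [Finset.mem_filter, Finset.mem_range, List.length_ofFn] at hi
    intro z hz hd
    dsimp only at hz hd
    rcases hi.2 with h | h
    · omega
    · refine h ?_
      rw [decide_eq_decide, hget _ (by omega), hget _ (by omega), hget _ (by omega)]
      convert! hd using 3
      · exact Fin.ext (by simp; omega)
      · exact Fin.ext (by simp; omega)

/-! ### Signed words built by insertion -/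

theorem ofFn_insertNth {α : Type*} {n : ℕ} (p : Fin (n + 1)) (M : α) (w : Fin n → α) :
    List.ofFn (Fin.insertNth p M w : Fin (n + 1) → α) = (List.ofFn w).insertIdx p M := by
  induction n with
  | zero =>
    obtain rfl : p = 0 := Fin.ext (by omega)
    simp [List.ofFn_succ]
  | succ n ih =>
    refine Fin.cases ?_ (fun q => ?_) p
    · simp [List.ofFn_succ]
    · rw [← Fin.cons_self_tail w, Fin.insertNth_succ_cons, List.ofFn_succ,
        List.ofFn_succ (f := Fin.cons _ _)]
      simp only [Fin.cons_zero, Fin.cons_succ, Fin.val_succ, List.insertIdx_succ_cons]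
      rw [← ih]

open Classical in
/-- The words `w` of length `n` whose absolute values are a permutation of `1, …, n` and whose
letters have signs in `E`. -/
noncomputable def wordSet (n : ℕ) (E : Finset ℤ) : Finset (Fin n → ℤ) :=
  (Fintype.piFinset fun _ => Finset.Icc (-(n : ℤ)) n).filter fun w =>
    Function.Injective (fun i => |w i|) ∧ ∀ i, 1 ≤ |w i| ∧ |w i| ≤ n ∧ (w i).sign ∈ E

theorem mem_wordSet {n : ℕ} {E : Finset ℤ} {w : Fin n → ℤ} :
    w ∈ wordSet n E ↔ Function.Injective (fun i => |w i|) ∧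
      ∀ i, 1 ≤ |w i| ∧ |w i| ≤ n ∧ (w i).sign ∈ E := by
  simp only [wordSet, Finset.mem_filter, Fintype.mem_piFinset, Finset.mem_Icc, ← abs_le,
    and_iff_right_iff_imp]
  exact fun h i => (h.2 i).2.1

theorem nodup_zero_cons {n : ℕ} {E : Finset ℤ} {w : Fin n → ℤ} (hw : w ∈ wordSet n E) :
    ((0 : ℤ) :: List.ofFn w).Nodup := by
  rw [mem_wordSet] at hw
  refine List.nodup_cons.2 ⟨fun h => ?_, List.nodup_ofFn.2 fun i j h => hw.1 (congrArg abs h)⟩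
  obtain ⟨i, hi⟩ := (List.mem_ofFn' w 0).1 h
  have := (hw.2 i).1
  rw [hi] at this
  simp at this

theorem exists_abs_eq {n : ℕ} {w : Fin (n + 1) → ℤ} (hinj : Function.Injective fun i => |w i|)
    (hw : ∀ i, 1 ≤ |w i| ∧ |w i| ≤ n + 1) : ∃ p, |w p| = n + 1 := by
  by_contra! h
  obtain ⟨i, -, j, -, hij, he⟩ := Finset.exists_ne_map_eq_of_card_lt_of_maps_to
    (s := (Finset.univ : Finset (Fin (n + 1)))) (t := Finset.Icc (1 : ℤ) n)
    (f := fun i => |w i|) (by simp) (fun i _ => by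
      have h1 := hw i
      have h2 := h i
      simp only [Finset.coe_Icc, Set.mem_Icc]
      omega)
  exact hij (hinj he)

theorem abs_mul_natCast_succ (n : ℕ) {e : ℤ} (he : e ∈ ({1, -1} : Finset ℤ)) :
    |e * ((n : ℤ) + 1)| = n + 1 := by
  rcases (by simpa using he : e = 1 ∨ e = -1) with rfl | rfl
  · rw [one_mul, abs_of_nonneg (by omega)]
  · rw [neg_one_mul, abs_neg, abs_of_nonneg (by omega)]

theorem sign_mul_natCast_succ (n : ℕ) {e : ℤ} (he : e ∈ ({1, -1} : Finset ℤ)) :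
    (e * ((n : ℤ) + 1)).sign = e := by
  rcases (by simpa using he : e = 1 ∨ e = -1) with rfl | rfl
  · rw [one_mul, Int.sign_eq_one_of_pos (by omega)]
  · rw [neg_one_mul, Int.sign_eq_neg_one_of_neg (by omega)]

theorem insertNth_mem_wordSet {n : ℕ} {E : Finset ℤ} (hE : E ⊆ {1, -1}) {w : Fin n → ℤ}
    (hw : w ∈ wordSet n E) {e : ℤ} (he : e ∈ E) (p : Fin (n + 1)) :
    (Fin.insertNth p (e * ((n : ℤ) + 1)) w : Fin (n + 1) → ℤ) ∈ wordSet (n + 1) E := by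
  have habs := abs_mul_natCast_succ n (hE he)
  have hsign := sign_mul_natCast_succ n (hE he)
  rw [mem_wordSet] at hw ⊢
  obtain ⟨hinj, hw⟩ := hw
  constructor
  · intro i j
    refine Fin.succAboveCases p ?_ (fun i => ?_) i <;>
      refine Fin.succAboveCases p ?_ (fun j => ?_) j
    · simp
    · have := hw j
      simp only [Fin.insertNth_apply_same, Fin.insertNth_apply_succAbove, habs]
      intro h
      omega
    · have := hw i
      simp only [Fin.insertNth_apply_same, Fin.insertNth_apply_succAbove, habs]
      intro h
      omega
    · simp only [Fin.insertNth_apply_succAbove]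
      intro h
      rw [hinj h]
  · intro i
    refine Fin.succAboveCases p ?_ (fun i => ?_) i
    · simp only [Fin.insertNth_apply_same, habs, hsign]
      push_cast
      exact ⟨by omega, le_rfl, he⟩
    · simp only [Fin.insertNth_apply_succAbove]
      have := hw i
      push_cast
      exact ⟨this.1, by omega, this.2.2⟩

/-- Every word of length `n + 1` arises from exactly one word of length `n` by insertion of a letter
of absolute value `n + 1`. -/
theorem sum_wordSet_succ {A : Type*} [AddCommMonoid A] (n : ℕ) {E : Finset ℤ}
    (hE : E ⊆ {1, -1}) (f : (Fin (n + 1) → ℤ) → A) :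
    ∑ w ∈ wordSet (n + 1) E, f w = ∑ w ∈ wordSet n E, ∑ e ∈ E, ∑ p : Fin (n + 1),
      f (Fin.insertNth p (e * ((n : ℤ) + 1)) w) := by
  have habs (e : ℤ) (he : e ∈ E) := abs_mul_natCast_succ n (hE he)
  have hsign (e : ℤ) (he : e ∈ E) := sign_mul_natCast_succ n (hE he)
  simp_rw [← Finset.sum_product']
  symm
  refine Finset.sum_bij (fun q _ => (Fin.insertNth q.2.2 (q.2.1 * ((n : ℤ) + 1)) q.1 : Fin (n + 1) → ℤ))
    ?_ ?_ ?_ (fun _ _ => rfl)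
  · rintro ⟨w, e, p⟩ hq
    simp only [Finset.mem_product, Finset.mem_univ, and_true] at hq
    exact insertNth_mem_wordSet hE hq.1 hq.2 p
  · rintro ⟨w, e, p⟩ hq ⟨w', e', p'⟩ hq' h
    simp only [Finset.mem_product, Finset.mem_univ, and_true, mem_wordSet] at hq hq' h
    have hp : p = p' := by
      by_contra hne
      obtain ⟨i, hi⟩ := Fin.exists_succAbove_eq hne
      have h1 := congrArg abs (congrFun h p)
      rw [Fin.insertNth_apply_same, habs e hq.2, ← hi, Fin.insertNth_apply_succAbove] at h1
      have := (hq'.1.2 i).2.1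
      omega
    subst hp
    obtain ⟨h1, rfl⟩ := Fin.insertNth_injective2 h
    have : e = e' := by rw [← hsign e hq.2, h1, hsign e' hq'.2]
    rw [this]
  · intro w hw
    rw [mem_wordSet] at hw
    obtain ⟨p, hp⟩ := exists_abs_eq hw.1 fun i => by
      have := hw.2 i
      push_cast at this
      exact ⟨this.1, this.2.1⟩
    -- The inverse deletes the letter of absolute value `n + 1`, remembering its sign and position.
    refine ⟨(fun i => w (p.succAbove i), (w p).sign, p), ?_, ?_⟩
    · simp only [Finset.mem_product, Finset.mem_univ, and_true, mem_wordSet]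
      refine ⟨⟨fun i j h => Fin.succAbove_right_injective (hw.1 h), fun i => ?_⟩, (hw.2 p).2.2⟩
      have h1 := hw.2 (p.succAbove i)
      have h2 : |w (p.succAbove i)| ≠ n + 1 := by
        rw [← hp]
        exact fun h => Fin.succAbove_ne p i (hw.1 h)
      push_cast at h1
      exact ⟨h1.1, by omega, h1.2.2⟩
    · dsimp only
      rw [← hp, Int.sign_mul_abs]
      exact Fin.insertNth_self_removeNth p w

theorem wordSet_zero (E : Finset ℤ) : wordSet 0 E = Finset.univ := by
  ext w
  simp only [mem_wordSet, Function.injective_of_subsingleton, IsEmpty.forall_iff, and_self,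
    Finset.mem_univ]

theorem lt_of_mem_ofFn {n : ℕ} {E : Finset ℤ} {w : Fin n → ℤ} (hw : w ∈ wordSet n E) :
    ∀ c ∈ List.ofFn w, c < (n : ℤ) + 1 := by
  intro c hc
  obtain ⟨i, rfl⟩ := (List.mem_ofFn' w c).1 hc
  have := ((mem_wordSet.1 hw).2 i).2.1
  have := le_abs_self (w i)
  omega

/-! ### Insertion recurrence for the up-down run polynomials -/

theorem upDownRunPoly_eq (n : ℕ) :
    upDownRunPoly n = ∑ w ∈ wordSet n {1}, X ^ turns false 0 (List.ofFn w) := by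
  have hinj (π : Equiv.Perm (Fin n)) : Function.Injective (permWord π) := by
    intro i j h
    simp only [permWord, add_left_inj, Nat.cast_inj] at h
    exact π.injective (Fin.ext h)
  have hpos (π : Equiv.Perm (Fin n)) (i : Fin n) : 0 < permWord π i := by
    simp only [permWord]
    omega
  refine Finset.sum_bij (fun π _ => permWord π) ?_ ?_ ?_ ?_
  · intro π _
    simp only [mem_wordSet, Finset.mem_singleton, abs_of_pos (hpos π _)]
    refine ⟨hinj π, fun i => ⟨hpos π i, ?_, Int.sign_eq_one_of_pos (hpos π i)⟩⟩
    have := (π i).isLt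
    simp only [permWord]
    omega
  · intro π _ σ _ h
    ext i
    have := congrFun h i
    simpa [permWord] using this
  · intro w hw
    rw [mem_wordSet] at hw
    have hw0 (i : Fin n) : 0 < w i := by
      have := (hw.2 i).2.2
      rwa [Finset.mem_singleton, Int.sign_eq_one_iff_pos] at this
    simp only [abs_of_pos (hw0 _)] at hw
    let g : Fin n → Fin n := fun i => ⟨(w i).toNat - 1, by
      have h1 := hw.2 i
      omega⟩
    have hg (i : Fin n) : ((g i : ℕ) : ℤ) + 1 = w i := by
      have h1 := hw0 i
      simp only [g]
      omega
    have hginj : Function.Injective g := by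
      intro i j h
      apply hw.1
      simp only [← hg, h]
    exact ⟨Equiv.ofBijective g (Finite.injective_iff_bijective.1 hginj), Finset.mem_univ _,
      funext hg⟩
  · intro π _
    rw [altSubseqLength, sSup_isAlternatingSubseq (hpos π) (hinj π)]

/-- Since x d/dx multiplies x^k by k, insertion acts as a differential operator independent of k. -/
theorem insertPoly_eq (k n : ℕ) :
    insertPoly k n = (X + (n : ℤ[X]) * X ^ 2) * X ^ k + X * (1 - X ^ 2) * derivative (X ^ k : ℤ[X]) := by
  have h : (X : ℤ[X]) * derivative (X ^ k : ℤ[X]) = (k : ℤ[X]) * X ^ k := by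
    cases k with
    | zero => simp
    | succ k =>
      simp only [derivative_X_pow, Nat.add_sub_cancel, map_natCast]
      ring
  rw [insertPoly]
  linear_combination (X ^ 2 - 1) * h

theorem upDownRunPoly_zero : upDownRunPoly 0 = 1 := by
  simp [upDownRunPoly_eq, wordSet_zero, turns]

theorem upDownRunPoly_succ (n : ℕ) :
    upDownRunPoly (n + 1) = (X + (n : ℤ[X]) * X ^ 2) * upDownRunPoly n +
      X * (1 - X ^ 2) * derivative (upDownRunPoly n) := by
  rw [upDownRunPoly_eq, sum_wordSet_succ n (by simp), upDownRunPoly_eq, derivative_sum,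
    Finset.mul_sum, Finset.mul_sum, ← Finset.sum_add_distrib]
  refine Finset.sum_congr rfl fun w hw => ?_
  rw [Finset.sum_singleton, one_mul, ← insertPoly_eq]
  have := (insertSum_eq (List.ofFn w) 0 (M := (n : ℤ) + 1) (by omega) (lt_of_mem_ofFn hw)).1
  rw [insertSum, List.length_ofFn, Finset.sum_range] at this
  rw [← this]
  exact Finset.sum_congr rfl fun p _ => by rw [ofFn_insertNth]

/-! ### Insertion recurrence over all signed words -/

/-- The generating polynomial of the number of alternating runs over all signed permutations. -/
noncomputable def signedRunPoly (n : ℕ) : ℤ[X] :=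
  ∑ w ∈ wordSet n {1, -1}, X ^ runs 0 (List.ofFn w)

theorem neg_mem_wordSet {n : ℕ} {w : Fin n → ℤ} (hw : w ∈ wordSet n {1, -1}) :
    -w ∈ wordSet n {1, -1} := by
  rw [mem_wordSet] at hw ⊢
  simp only [Pi.neg_apply, abs_neg]
  refine ⟨hw.1, fun i => ⟨(hw.2 i).1, (hw.2 i).2.1, ?_⟩⟩
  have := (hw.2 i).2.2
  simp only [Finset.mem_insert, Finset.mem_singleton, Int.sign_neg] at this ⊢
  omega

theorem runs_ofFn_neg {n : ℕ} {E : Finset ℤ} {w : Fin n → ℤ} (hw : w ∈ wordSet n E) :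
    runs 0 (List.ofFn (-w)) = runs 0 (List.ofFn w) := by
  have := runs_neg 0 _ (nodup_zero_cons hw)
  rwa [neg_zero, List.map_ofFn] at this

theorem sum_runs_insertNth {n : ℕ} {w : Fin (n + 1) → ℤ} (hw : w ∈ wordSet (n + 1) {1, -1}) :
    ∑ p : Fin (n + 1 + 1), X ^ runs 0 (List.ofFn
      (Fin.insertNth p (((n + 1 : ℕ) : ℤ) + 1) w : Fin (n + 1 + 1) → ℤ)) =
    insertPoly (runs 0 (List.ofFn w)) (n + 1) + if 0 < w 0 then (0 : ℤ[X]) else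
      X ^ (runs 0 (List.ofFn w) + 1) - X ^ runs 0 (List.ofFn w) := by
  have hlt := lt_of_mem_ofFn hw
  have hlen : (List.ofFn w).length = n + 1 := List.length_ofFn
  simp only [ofFn_insertNth]
  rw [← Finset.sum_range fun p => (X : ℤ[X]) ^ runs 0 ((List.ofFn w).insertIdx p
    (((n + 1 : ℕ) : ℤ) + 1))]
  rw [List.ofFn_succ] at hlt hlen ⊢
  have := sum_runs_insertIdx (a := 0) (M := ((n + 1 : ℕ) : ℤ) + 1) (by omega) hlt
  rwa [hlen] at this

theorem ne_zero_of_mem_wordSet {n : ℕ} {E : Finset ℤ} {w : Fin n → ℤ} (hw : w ∈ wordSet n E)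
    (i : Fin n) : w i ≠ 0 := by
  have := ((mem_wordSet.1 hw).2 i).1
  intro h
  simp [h] at this

/-- Inserting the negative letter into `w` amounts, after negation, to inserting the positive one
into `-w`, with equal run counts. Exactly one of `w`, `-w` starts below 0, so the correction x^(k+1)
- x^k occurs once per word. -/
theorem signedRunPoly_succ_succ (n : ℕ) :
    signedRunPoly (n + 2) = (3 * X - 1 + 2 * ((n + 1 : ℕ) : ℤ[X]) * X ^ 2) * signedRunPoly (n + 1) +
      2 * X * (1 - X ^ 2) * derivative (signedRunPoly (n + 1)) := by
  rw [signedRunPoly, sum_wordSet_succ (n + 1) subset_rfl, signedRunPoly, derivative_sum,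
    Finset.mul_sum, Finset.mul_sum, ← Finset.sum_add_distrib]
  refine Finset.sum_congr rfl fun w hw => ?_
  rw [Finset.sum_pair (by norm_num)]
  have h1 := sum_runs_insertNth hw
  have h2 := sum_runs_insertNth (neg_mem_wordSet hw)
  rw [runs_ofFn_neg hw] at h2
  have h3 : ∑ p : Fin (n + 2), (X : ℤ[X]) ^ runs 0 (List.ofFn
      (Fin.insertNth p (-1 * (((n + 1 : ℕ) : ℤ) + 1)) w : Fin (n + 2) → ℤ)) =
      ∑ p : Fin (n + 2), X ^ runs 0 (List.ofFn
      (Fin.insertNth p (((n + 1 : ℕ) : ℤ) + 1) (-w) : Fin (n + 2) → ℤ)) := by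
    refine Finset.sum_congr rfl fun p _ => ?_
    rw [← runs_ofFn_neg (insertNth_mem_wordSet subset_rfl hw (e := -1) (by simp) p)]
    congr 3
    ext i
    refine Fin.succAboveCases p ?_ (fun i => ?_) i <;> simp
  rw [h3, h2]
  simp only [one_mul]
  rw [h1, insertPoly_eq]
  have h0 := ne_zero_of_mem_wordSet hw 0
  simp only [Pi.neg_apply]
  rcases lt_or_gt_of_ne h0 with h | h
  · rw [if_neg h.not_gt, if_pos (by omega)]
    push_cast
    ring
  · rw [if_pos h, if_neg (by omega)]
    push_cast
    ring

theorem signedRunPoly_one : signedRunPoly 1 = 2 * X := by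
  rw [signedRunPoly, sum_wordSet_succ 0 subset_rfl, wordSet_zero]
  simp [List.ofFn_succ, runs, turns]

theorem signedRunPoly_succ_eq (n : ℕ) :
    signedRunPoly (n + 1) =
      2 * ∑ w ∈ (wordSet (n + 1) {1, -1}).filter (fun w => 0 < w 0), X ^ runs 0 (List.ofFn w) := by
  rw [signedRunPoly, ← Finset.sum_filter_add_sum_filter_not _ fun w : Fin (n + 1) → ℤ => 0 < w 0,
    two_mul]
  congr 1
  refine Finset.sum_bij' (fun w _ => -w) (fun w _ => -w) ?_ ?_ (by simp) (by simp) ?_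
  · intro w hw
    rw [Finset.mem_filter] at hw ⊢
    have := ne_zero_of_mem_wordSet hw.1 0
    exact ⟨neg_mem_wordSet hw.1, by simp only [Pi.neg_apply]; omega⟩
  · intro w hw
    rw [Finset.mem_filter] at hw ⊢
    exact ⟨neg_mem_wordSet hw.1, by simp only [Pi.neg_apply]; omega⟩
  · intro w hw
    rw [runs_ofFn_neg (Finset.mem_filter.1 hw).1]

/-! ### Signed permutations as words -/

/-- The word `π(1) ⋯ π(n)` of a signed permutation. -/
noncomputable def signedLetters {n : ℕ} (π : SignedPerm n) : Fin n → ℤ :=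
  fun i => (π.1 ⟨((i : ℕ) : ℤ) + 1, succ_mem_pmRange i⟩ : ℤ)

theorem mem_pmRange {n : ℕ} {z : ℤ} : z ∈ pmRange n ↔ 1 ≤ |z| ∧ |z| ≤ n := by
  simp only [pmRange, Finset.mem_erase, Finset.mem_Icc, Int.abs_eq_natAbs]
  omega

theorem signedLetters_mem {n : ℕ} (π : SignedPerm n) : signedLetters π ∈ wordSet n {1, -1} := by
  rw [mem_wordSet]
  constructor
  · intro i j h
    rcases abs_eq_abs.1 h with h | h
    · have h1 := π.1.injective (Subtype.ext h)
      simp only [Subtype.mk.injEq] at h1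
      exact Fin.ext (by omega)
    · have hm : -(((j : ℕ) : ℤ) + 1) ∈ pmRange n := by
        rw [mem_pmRange, abs_neg, ← mem_pmRange]
        exact succ_mem_pmRange j
      have h2 := π.2 ⟨((j : ℕ) : ℤ) + 1, succ_mem_pmRange j⟩ ⟨_, hm⟩ rfl
      have h1 := π.1.injective (Subtype.ext (h.trans h2.symm))
      simp only [Subtype.mk.injEq] at h1
      omega
  · intro i
    have h := mem_pmRange.1 (π.1 ⟨((i : ℕ) : ℤ) + 1, succ_mem_pmRange i⟩).2
    refine ⟨h.1, h.2, ?_⟩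
    have h0 : signedLetters π i ≠ 0 := abs_pos.1 h.1
    rcases lt_or_gt_of_ne h0 with h0 | h0
    · simp [Int.sign_eq_neg_one_of_neg h0]
    · simp [Int.sign_eq_one_of_pos h0]

theorem signedLetters_injective (n : ℕ) :
    Function.Injective (signedLetters : SignedPerm n → Fin n → ℤ) := by
  intro π σ h
  have hpos (z : pmRange n) (hz : 0 < (z : ℤ)) : (π.1 z : ℤ) = σ.1 z := by
    have hz2 := mem_pmRange.1 z.2
    rw [abs_of_pos hz] at hz2
    have e : z = ⟨(((⟨(z : ℤ).toNat - 1, by omega⟩ : Fin n) : ℕ) : ℤ) + 1, succ_mem_pmRange _⟩ :=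
      Subtype.ext (by simp only; omega)
    rw [e]
    exact congrFun h _
  refine Subtype.ext (Equiv.ext fun z => Subtype.ext ?_)
  have hz0 : (z : ℤ) ≠ 0 := abs_pos.1 (mem_pmRange.1 z.2).1
  rcases lt_or_gt_of_ne hz0 with hz | hz
  · have hm : -(z : ℤ) ∈ pmRange n := by
      rw [mem_pmRange, abs_neg, ← mem_pmRange]
      exact z.2
    have e := hpos ⟨_, hm⟩ (by simp only; omega)
    rw [π.2 z ⟨_, hm⟩ rfl, σ.2 z ⟨_, hm⟩ rfl] at e
    omega
  · exact hpos z hz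

theorem exists_signedLetters_eq {n : ℕ} {w : Fin n → ℤ} (hw : w ∈ wordSet n {1, -1}) :
    ∃ π : SignedPerm n, signedLetters π = w := by
  have hw0 := ne_zero_of_mem_wordSet hw
  rw [mem_wordSet] at hw
  let ind (z : pmRange n) : Fin n := ⟨(z : ℤ).natAbs - 1, by
    have := mem_pmRange.1 z.2
    rw [Int.abs_eq_natAbs] at this
    omega⟩
  have hind (z : pmRange n) : ((ind z : ℕ) : ℤ) + 1 = |(z : ℤ)| := by
    have := mem_pmRange.1 z.2
    rw [Int.abs_eq_natAbs] at this ⊢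
    simp only [ind]
    omega
  have habs (z : pmRange n) : |(z : ℤ).sign * w (ind z)| = |w (ind z)| := by
    have : (z : ℤ) ≠ 0 := abs_pos.1 (mem_pmRange.1 z.2).1
    rw [abs_mul, Int.abs_sign_of_ne_zero this, one_mul]
  -- The odd extension z ↦ sgn(z) · w(|z|).
  let g (z : pmRange n) : pmRange n := ⟨(z : ℤ).sign * w (ind z), by
    rw [mem_pmRange, habs]
    exact ⟨(hw.2 _).1, (hw.2 _).2.1⟩⟩
  have hg : Function.Injective g := by
    intro x y hxy
    have h1 : (x : ℤ).sign * w (ind x) = (y : ℤ).sign * w (ind y) := congrArg Subtype.val hxy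
    have h2 : ind x = ind y := hw.1 (by
      have := congrArg abs h1
      rwa [habs, habs] at this)
    rw [h2] at h1
    have h3 := mul_right_cancel₀ (hw0 _) h1
    have h4 : |(x : ℤ)| = |(y : ℤ)| := by rw [← hind, ← hind, h2]
    exact Subtype.ext (by rw [← Int.sign_mul_abs (x : ℤ), h3, h4, Int.sign_mul_abs])
  refine ⟨⟨Equiv.ofBijective g (Finite.injective_iff_bijective.1 hg), ?_⟩, ?_⟩
  · intro i j hij
    have h1 : ind j = ind i := Fin.ext (by
      have h1 := hind i
      have h2 := hind j
      rw [hij, abs_neg] at h2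
      omega)
    simp only [Equiv.ofBijective_apply, g, h1, hij, Int.sign_neg, neg_mul]
  · funext i
    simp only [signedLetters, Equiv.ofBijective_apply, g]
    rw [Int.sign_eq_one_of_pos (by omega), one_mul]
    congr 1

theorem upSignedCount_succ (n k : ℕ) :
    upSignedCount (n + 1) k = (((wordSet (n + 1) {1, -1}).filter fun w => 0 < w 0).filter
      fun w => runs 0 (List.ofFn w) = k).card := by
  have hruns (π : SignedPerm (n + 1)) :
      runCount (signedWord π) = runs 0 (List.ofFn (signedLetters π)) := by
    refine runCount_cons (w := signedLetters π) ?_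
    have := nodup_zero_cons (signedLetters_mem π)
    rw [← List.nodup_ofFn, List.ofFn_succ]
    simpa using this
  have hup (π : SignedPerm (n + 1)) : IsUp π ↔ 0 < signedLetters π 0 := by
    constructor
    · intro h
      exact h (Fin.succ 0) rfl
    · intro h i hi
      obtain rfl : i = Fin.succ 0 := Fin.ext hi
      exact h
  rw [upSignedCount, ← Nat.card_eq_finsetCard]
  refine Nat.card_congr (Equiv.ofBijective (fun π => ⟨signedLetters π.1, ?_⟩) ⟨?_, ?_⟩)
  · simp only [Finset.mem_filter]
    exact ⟨⟨signedLetters_mem _, (hup _).1 π.2.1⟩, (hruns _).symm.trans π.2.2⟩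
  · intro π σ h
    exact Subtype.ext (signedLetters_injective _ (congrArg Subtype.val h))
  · rintro ⟨w, hw⟩
    simp only [Finset.mem_filter] at hw
    obtain ⟨π, rfl⟩ := exists_signedLetters_eq hw.1.1
    exact ⟨⟨π, (hup π).2 hw.1.2, (hruns π).trans hw.2⟩, rfl⟩

theorem signedRunPoly_eq_two_mul (n : ℕ) : signedRunPoly (n + 1) = 2 * typeBRunPoly (n + 1) := by
  rw [signedRunPoly_succ_eq, typeBRunPoly, ← Finset.sum_fiberwise_of_maps_to
    (t := Finset.Icc 1 (n + 1)) (g := fun w => runs 0 (List.ofFn w))]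
  · congr 1
    refine Finset.sum_congr rfl fun k _ => ?_
    rw [upSignedCount_succ, Finset.sum_congr rfl fun w hw =>
      congrArg (fun r => (X : ℤ[X]) ^ r) (Finset.mem_filter.1 hw).2, Finset.sum_const, nsmul_eq_mul]
  -- Truncating to exponents 1, …, n + 1 loses nothing: each step of a nonempty word starts at most
  -- one run.
  · intro w _
    rw [Finset.mem_Icc]
    refine ⟨runs_pos _ (by simp [List.ofFn_succ]), ?_⟩
    simpa using runs_le 0 (List.ofFn w)

theorem typeBRunPoly_one : typeBRunPoly 1 = X :=
  mul_left_cancel₀ (two_ne_zero' ℤ[X]) ((signedRunPoly_eq_two_mul 0).symm.trans signedRunPoly_one)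

theorem typeBRunPoly_succ_succ (n : ℕ) :
    typeBRunPoly (n + 1 + 1) = (3 * X - 1 + 2 * X ^ 2 + (n : ℤ[X]) * (2 * X ^ 2)) *
      typeBRunPoly (n + 1) + 2 * X * (1 - X ^ 2) * derivative (typeBRunPoly (n + 1)) := by
  refine mul_left_cancel₀ (two_ne_zero' ℤ[X]) ?_
  have h := signedRunPoly_succ_succ n
  rw [signedRunPoly_eq_two_mul, signedRunPoly_eq_two_mul, derivative_mul, derivative_ofNat] at h
  rw [h]
  push_cast
  ring

/-! ### The convolution identity and the determinant -/

/-- The factor 2^n doubles the recurrence for S, and differentiating the factor x contributes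
-2(1-x²) to the constant. This gives 2x - 2 + 2x², the sum of 3x - 1 + 2x² for T and -x - 1 for u.
-/
theorem sum_choose_mul_typeBRunPoly (n : ℕ) :
    ∑ p ∈ Finset.HasAntidiagonal.antidiagonal n,
      (n.choose p.1 : ℤ[X]) * (typeBRunPoly (p.1 + 1) * uPoly p.2) =
      2 ^ n * X * upDownRunPoly n := by
  refine sum_choose_mul_mul_eq (A := fun n => typeBRunPoly (n + 1)) (B := uPoly)
    (C := fun n => 2 ^ n * X * upDownRunPoly n) (b := -X - 1)
    (c := 2 * X - 2 + 2 * X ^ 2) ?_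
    typeBRunPoly_succ_succ (fun m => (uPoly_succ m).trans ?_) ?_ ?_ n
  · ring
  · ring
  · intro m
    have h2 : derivative ((2 : ℤ[X]) ^ m) = 0 := by
      rw [show (2 : ℤ[X]) ^ m = C (2 ^ m) by simp]
      exact derivative_C
    simp only [upDownRunPoly_succ, derivative_mul, derivative_X, h2]
    ring
  · simp [typeBRunPoly_one, upDownRunPoly_zero, uPoly]

theorem typeBRunPoly_succ_eq (n : ℕ) :
    typeBRunPoly (n + 1) = 2 ^ n * X * upDownRunPoly n +
      ∑ k ∈ Finset.range n, (n.choose k : ℤ[X]) * tPoly (n - k) * typeBRunPoly (k + 1) := by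
  rw [← sum_choose_mul_typeBRunPoly, Finset.Nat.sum_antidiagonal_eq_sum_range_succ
    (fun i j => (n.choose i : ℤ[X]) * (typeBRunPoly (i + 1) * uPoly j)), Finset.sum_range_succ,
    add_right_comm, ← Finset.sum_add_distrib, Finset.sum_eq_zero]
  · simp [uPoly]
  · intro k hk
    obtain ⟨m, hm⟩ : ∃ m, n - k = m + 1 := ⟨n - k - 1, by have := Finset.mem_range.1 hk; omega⟩
    rw [hm, tPoly_succ]
    ring

end AltRun

/-- Rows and columns are numbered from `0` to `n`. -/
theorem mainTheorem3 (n : ℕ) (hn : 1 ≤ n) :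
    AltRun.typeBRunPoly (n + 1) =
      (Matrix.of fun i j : Fin (n + 1) =>
        if (j : ℕ) = 0 then
          2 ^ (i : ℕ) * Polynomial.X * AltRun.upDownRunPoly (i : ℕ)
        else if (j : ℕ) ≤ (i : ℕ) then
          (Nat.choose (i : ℕ) ((j : ℕ) - 1) : Polynomial ℤ) *
            AltRun.tPoly ((i : ℕ) - (j : ℕ) + 1)
        else if (j : ℕ) = (i : ℕ) + 1 then
          -(Nat.choose (i : ℕ) (i : ℕ) : Polynomial ℤ)
        else 0).det := by
  symm
  refine AltRun.det_hessenberg n (fun i j : ℕ =>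
    if j = 0 then 2 ^ i * Polynomial.X * AltRun.upDownRunPoly i
    else if j ≤ i then (Nat.choose i (j - 1) : Polynomial ℤ) * AltRun.tPoly (i - j + 1)
    else if j = i + 1 then -(Nat.choose i i : Polynomial ℤ) else 0)
    -- The value 1 at 0 lets column 0 supply the inhomogeneous term 2^i x S_i; column k + 1
    -- multiplies T_{k+1}.
    (fun j => if j = 0 then 1 else AltRun.typeBRunPoly j) rfl ?_ ?_ ?_
  · intro i
    simp
  · intro i j hij
    rw [if_neg (by omega), if_neg (by omega), if_neg (by omega)]
  · intro i _
    rw [Finset.sum_range_succ']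
    simp only [Nat.add_eq_zero_iff, one_ne_zero, and_false, if_false, if_true, mul_one]
    rw [AltRun.typeBRunPoly_succ_eq, add_comm]
    congr 1
    refine Finset.sum_congr rfl fun k hk => ?_
    have := Finset.mem_range.1 hk
    rw [if_pos (by omega), Nat.add_sub_cancel, show i - (k + 1) + 1 = i - k by omega]
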